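/- A Fibonacci word is a finite word $w$ in the letters $1,2$; $|w|$ is the sum of its letters, and $\mathbb{YF}_n$ is the set of words with $|w|=n$. In the Young--Fibonacci lattice, $w\nearrow w'$ means that $w'=1w$; or $w=2^k1v$ and $w'=2^{k+1}v$ with $k\ge 0$; or $w=2^kv$ and $w'=2^{l}12^{k-l}v$ with $1\le l\le k$. Let $\dim w$ be the number of saturated chains from $\varnothing$ to $w$, and $\varphi_{\mathrm{PL}}(w)=\dim(w)/|w|!$. For real sequences $\vec x=(x_1,x_2,\dots)$, $\vec y=(y_1,y_2,\dots)$ let $A_\ell(\vec x\mid\vec y)$ ($\ell\ge0$) be the $\ell\times\ell$ tridiagonal determinant with diagonal $x_1,x_2,\dots$, superdiagonal $y_1,y_2,\dots$ and subdiagonal $1,1,\dots$; let $B_k(\vec x\mid\vec y)$ ($k\ge0$) be the $(k+1)\times(k+1)$ tridiagonal determinant with diagonal $y_1,x_3,x_4,\dots$, superdiagonal $x_1y_2,y_3,y_4,\dots$ and subdiagonal $1,1,\dots$. With $\vec u+m=(u_{m+1},u_{m+2},\dots)$, the clone Schur functions are $s_{1^k}=A_k(\vec x\mid\vec y)$ and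 $s_{1^k2u}=B_k(\vec x+|u|\mid\vec y+|u|)\,s_u$. Assume that $(\vec x,\vec y)$ is Fibonacci positive, i.e. $s_w(\vec x\mid\vec y)>0$ for all Fibonacci words $w$, and put $\varphi_{\vec x,\vec y}(w)=s_w(\vec x\mid\vec y)/(x_1\cdots x_{|w|})$. For $\sigma\in\mathfrak S_n$, the Young--Fibonacci insertion tableau $P(\sigma)$ is built by reading $\sigma_1\cdots\sigma_n$ from right to left: each unmatched entry $a$ that is read is matched with the largest unmatched entry $m$ to its left if $m>a$, giving a column with $m$ above $a$; otherwise $a$ alone forms a column of height one. The columns are arranged from left to right in the order of reading, and the shape $w\in\mathbb{YF}_n$ of $P(\sigma)$ is the word of column heights. To a standard Young--Fibonacci tableau $T$ of shape $w\in\mathbb{YF}_n$ is associated the saturated chain $\varnothing=w_0\nearrow\cdots\nearrow w_n=w$ of the shapes obtained by repeatedly applying the elimination map. This map deletes the largest entry, which is the top of the first column. If that column had a bottom entry $a$, then $a$ moves to the right: if the next column has top $b>a$, then $a$ becomes the bottom entry of that column and the previous bottom entry, if any, moves on in the same way; otherwise (or if there is no next column) $a$ forms a column of height one at that place. For a positive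 harmonic function $\varphi$ the cotransition probabilities are $\mu^{\varphi}_{\mathrm{CT}}(w,v)=1$ if $w=1v$, $\;\varphi(v)/\varphi(u)$ if $w=2u$ and $v\nearrow w$, and $0$ if $v\not\nearrow w$; put $\overline\mu^{\varphi}_{\mathrm{CT}}(T)=\prod_{k=1}^n\mu^{\varphi}_{\mathrm{CT}}(w_k,w_{k-1})$. For an involution $\sigma\in\mathfrak S_n$ (i.e. $\sigma^2=1$) such that $P(\sigma)$ has shape $w$, set $$\nu_n(\sigma)=\dim(w)\,\varphi_{\vec x,\vec y}(w)\,\overline\mu^{\varphi_{\mathrm{PL}}}_{\mathrm{CT}}(P(\sigma)),$$ and $\nu_n(\sigma)=0$ if $\sigma$ is not an involution. **Proposition.** For every $n\ge0$, $\nu_n$ is a probability distribution on $\mathfrak S_n$, and for every $\tau\in\mathbb C$, $$\mathbb E_{\nu_n}\bigl[\tau^{\#\text{two-cycles}(\sigma)}\bigr]=(x_1\cdots x_n)^{-1}\det \underbrace{\begin{pmatrix} x_1&(1-\tau)y_1&-\tau x_1y_2&0&\cdots\\ 1&x_2&(1-2\tau)y_2&-2\tau x_2y_3&\\ 0&1&x_3&(1-3\tau)y_3&\\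 0&0&1&x_4&\\ \vdots&&&&\ddots \end{pmatrix}}_{n\times n},$$ where row $k$ has $x_k$ on the diagonal, followed by $(1-k\tau)y_k$ and $-k\tau x_ky_{k+1}$, is preceded by $1$ on the subdiagonal, and is zero elsewhere. -/

import Mathlib

namespace YoungFibonacci

/-- A Fibonacci word: a finite word in the letters `1` and `2`, read from left to right.
`one v` is the word `1v` and `two v` is the word `2v`. -/
inductive FibWord : Type where
  | empty : FibWord
  | one (v : FibWord) : FibWord
  | two (v : FibWord) : FibWord

/-- The weight `|w|` of a Fibonacci word: the sum of its letters. -/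
def FibWord.weight : FibWord → ℕ
  | .empty => 0
  | .one v => v.weight + 1
  | .two v => v.weight + 2

/-- The edge relation `w ↗ w'` of the Young–Fibonacci lattice: either `w' = 1w`; or
`w = 2^k 1 v` and `w' = 2^(k+1) v`; or `w = 2^k v` and `w' = 2^l 1 2^(k-l) v` with `1 ≤ l ≤ k`. -/
def FibWord.Edge (w w' : FibWord) : Prop :=
  w' = .one w ∨
  (∃ (k : ℕ) (v : FibWord), w = FibWord.two^[k] (.one v) ∧ w' = FibWord.two^[k + 1] v) ∨
  (∃ (k l : ℕ) (v : FibWord), 1 ≤ l ∧ l ≤ k ∧ w = FibWord.two^[k] v ∧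
    w' = FibWord.two^[l] (.one (FibWord.two^[k - l] v)))

/-- Saturated chains `∅ = w₀ ↗ w₁ ↗ ⋯ ↗ wₙ = w` in the Young–Fibonacci lattice. -/
inductive SaturatedChain : FibWord → Type where
  | start : SaturatedChain FibWord.empty
  | extend {v w : FibWord} (c : SaturatedChain v) (h : v.Edge w) : SaturatedChain w

/-- `dim w` is the number of saturated chains from `∅` to `w`. -/
noncomputable def dim (w : FibWord) : ℕ := Nat.card (SaturatedChain w)

/-- The Plancherel harmonic function `dim w / |w|!`. -/
noncomputable def plancherel (w : FibWord) : ℝ := (dim w : ℝ) / (w.weight.factorial : ℝ)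

/-! ### Clone Schur functions

A sequence `x₁, x₂, …` is a function `x : ℕ → R`; the value `x 0` is never used. -/

/-- The `l × l` tridiagonal determinant `A_l(x | y)`: diagonal `x₁, x₂, …`, superdiagonal
`y₁, y₂, …`, subdiagonal `1, 1, …`. -/
def detA {R : Type*} [CommRing R] (x y : ℕ → R) (l : ℕ) : R :=
  Matrix.det (Matrix.of fun i j : Fin l =>
    if (j : ℕ) = i then x (i + 1)
    else if (j : ℕ) = i + 1 then y (i + 1)
    else if (i : ℕ) = j + 1 then 1
    else 0)

/-- The `(k + 1) × (k + 1)` tridiagonal determinant `B_k(x | y)`: diagonal `y₁, x₃, x₄, …`,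
superdiagonal `x₁ y₂, y₃, y₄, …`, subdiagonal `1, 1, …`. -/
def detB {R : Type*} [CommRing R] (x y : ℕ → R) (k : ℕ) : R :=
  Matrix.det (Matrix.of fun i j : Fin (k + 1) =>
    if (j : ℕ) = i then (if (i : ℕ) = 0 then y 1 else x (i + 2))
    else if (j : ℕ) = i + 1 then (if (i : ℕ) = 0 then x 1 * y 2 else y (i + 2))
    else if (i : ℕ) = j + 1 then 1
    else 0)

/-- The shifted sequence `u + m = (u_{m+1}, u_{m+2}, …)`. -/
def shift {R : Type*} (u : ℕ → R) (m : ℕ) : ℕ → R := fun k => u (k + m)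

/-- `cloneSchurAux x y k w` is the clone Schur function of the word `1^k w`. -/
def cloneSchurAux {R : Type*} [CommRing R] (x y : ℕ → R) : ℕ → FibWord → R
  | k, .empty => detA x y k
  | k, .one v => cloneSchurAux x y (k + 1) v
  | k, .two u => detB (shift x u.weight) (shift y u.weight) k * cloneSchurAux x y 0 u

/-- The biserial clone Schur function `s_w(x | y)`: it equals `A_k(x | y)` for `w = 1^k`, and
`B_k(x + |u| | y + |u|) · s_u(x | y)` for `w = 1^k 2 u`. -/
def cloneSchur {R : Type*} [CommRing R] (x y : ℕ → R) (w : FibWord) : R := cloneSchurAux x y 0 w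

/-- `(x, y)` is Fibonacci positive if `s_w(x | y) > 0` for every Fibonacci word `w`. -/
def FibonacciPositive (x y : ℕ → ℝ) : Prop := ∀ w : FibWord, 0 < cloneSchur x y w

/-- The clone harmonic function `φ_{x,y}(w) = s_w(x | y) / (x₁ ⋯ x_{|w|})`. -/
noncomputable def cloneHarmonic (x y : ℕ → ℝ) (w : FibWord) : ℝ :=
  cloneSchur x y w / ∏ k ∈ Finset.Icc 1 w.weight, x k

/-! ### Tableaux and the Robinson–Schensted correspondence -/

/-- A labelled column of a Young–Fibonacci diagram, of height one or two. -/
inductive Column : Type where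
  | single (a : ℕ) : Column
  | double (top bottom : ℕ) : Column

/-- The shape of a Young–Fibonacci tableau, given as the list of its columns from left to right. -/
def shape : List Column → FibWord
  | [] => .empty
  | .single _ :: T => .one (shape T)
  | .double _ _ :: T => .two (shape T)

/-- The insertion tableau of a word, where the input lists the entries of the word from right to
left. The entry `a` currently read is matched with the maximal unmatched entry `m` to its left,
and gives the column with `m` on top and `a` at the bottom; if no unmatched entry to its left is
larger than `a`, then `a` forms a column of height one. -/
def insertionTableau : List ℕ → List Column
  | [] => []
  | a :: r =>
    let m := r.foldr max a
    if m = a then .single a :: insertionTableau r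
    else .double m a :: insertionTableau (r.erase m)
termination_by l => l.length
decreasing_by
  · simp
  · exact Nat.lt_succ_of_le (List.length_erase_le ..)

/-- The insertion tableau `P(σ)` of a permutation `σ` of `{1, …, n}`, here indexed by `Fin n`. -/
def tableauP {n : ℕ} (σ : Equiv.Perm (Fin n)) : List Column :=
  insertionTableau (List.ofFn fun i : Fin n => (σ i : ℕ) + 1).reverse

/-- The entry `a` moves into the columns on its right. If the top entry of the next column is
larger than `a`, then `a` becomes the bottom entry of that column and the previous bottom entry,
if any, moves on in the same way; otherwise `a` becomes a column of height one. -/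
def bump : ℕ → List Column → List Column
  | a, [] => [.single a]
  | a, .single b :: T =>
    if a < b then .double b a :: T else .single a :: .single b :: T
  | a, .double b c :: T =>
    if a < b then .double b a :: bump c T else .single a :: .double b c :: T

/-- The elimination map on standard Young–Fibonacci tableaux: it removes the largest entry, which
is the top entry of the first column. -/
def eliminate : List Column → List Column
  | [] => []
  | .single _ :: T => T
  | .double _ a :: T => bump a T

open Classical in
/-- The cotransition probability `μ_CT^φ(w, v)` from `w` down to `v`: it is `1` if `w = 1v`,
`φ(v) / φ(u)` if `w = 2u` and `v ↗ w`, and `0` if not `v ↗ w`. -/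
noncomputable def cotransition (φ : FibWord → ℝ) (w v : FibWord) : ℝ :=
  if v.Edge w then
    match w with
    | .empty => 0
    | .one _ => 1
    | .two u => φ v / φ u
  else 0

/-- The cotransition weight of a tableau `T` with `n` boxes: the product of the cotransition
probabilities along the saturated chain `wₙ ↘ ⋯ ↘ w₁ ↘ w₀ = ∅` associated to `T`, where
`w_{n-j}` is the shape of the tableau obtained from `T` by `j` eliminations. -/
noncomputable def chainWeight (φ : FibWord → ℝ) (T : List Column) : ℝ :=
  ∏ j ∈ Finset.range (shape T).weight,
    cotransition φ (shape (eliminate^[j] T)) (shape (eliminate^[j + 1] T))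

/-- The probability `ν_n(σ | π, φ) = dim(w) π(w) μ_CT^φ(P(σ))` of an involution `σ ∈ S_n`, where
`w` is the shape of `P(σ)`. Permutations that are not involutions have probability `0`. -/
noncomputable def nu (π φ : FibWord → ℝ) {n : ℕ} (σ : Equiv.Perm (Fin n)) : ℝ :=
  if σ * σ = 1 then
    (dim (shape (tableauP σ)) : ℝ) * π (shape (tableauP σ)) * chainWeight φ (tableauP σ)
  else 0

/-- The `n × n` quadridiagonal matrix with rows `k = 1, …, n`: row `k` has `x_k` on the diagonal,
then `(1 - kτ) y_k` and `-kτ x_k y_{k+1}` to the right of it, and `1` to the left of it. -/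
def quadridiagonal {R : Type*} [CommRing R] (x y : ℕ → R) (τ : R) (n : ℕ) :
    Matrix (Fin n) (Fin n) R :=
  Matrix.of fun i j : Fin n =>
    if (j : ℕ) = i then x (i + 1)
    else if (j : ℕ) = i + 1 then (1 - ((i + 1 : ℕ) : R) * τ) * y (i + 1)
    else if (j : ℕ) = i + 2 then -((i + 1 : ℕ) : R) * τ * x (i + 1) * y (i + 2)
    else if (i : ℕ) = j + 1 then 1
    else 0

end YoungFibonacci

namespace YoungFibonacci

open FibWord

/-! ### The Young–Fibonacci lattice -/

/-! Everything reduces to an identity between weighted sums over Fibonacci words. For the Plancherel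
function each cotransition probability along an edge is a ratio of dimensions, so the product along
the chain of a tableau telescopes to `1 / dim w` (`chainWeight_plancherel`). This rests on `dim (2v)
= (|v| + 1) dim v` (`dim_two`). Hence `ν` of an involution is just the clone harmonic function at
its shape. Splitting the involutions by the image of the largest point shows that shapes and
two-cycles obey a recursion: a fixed point contributes a letter `1`, and each of the `n - 1`
possible partners contributes a letter `2` and a factor `τ` (`sum_involutions`). The resulting sum
is `wordSum`. The Hessenberg recurrences for `A` and `B` turn this recursion, applied to clone Schur
functions, into the four-term recurrence of the quadridiagonal determinant
(`wordSum_cloneSchur_add_three`, `quadridiagonal_det_add_three`). At `τ = 1` its solution is `x₁ ⋯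
xₙ`, which gives total mass one. -/

theorem FibWord.edge_one_iff {v w : FibWord} : v.Edge (.one w) ↔ v = w := by
  constructor
  · rintro (h | ⟨k, u, -, h⟩ | ⟨k, l, u, hl, -, -, h⟩)
    · exact (FibWord.one.inj h).symm
    · simp [Function.iterate_succ_apply'] at h
    · obtain ⟨l, rfl⟩ := Nat.exists_eq_add_of_le' hl
      simp [Function.iterate_succ_apply'] at h
  · rintro rfl
    exact .inl rfl

theorem FibWord.not_edge_empty (v : FibWord) : ¬ v.Edge .empty := by
  rintro (h | ⟨k, u, -, h⟩ | ⟨k, l, u, hl, -, -, h⟩)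
  · cases h
  · simp [Function.iterate_succ_apply'] at h
  · obtain ⟨l, rfl⟩ := Nat.exists_eq_add_of_le' hl
    simp [Function.iterate_succ_apply'] at h

theorem FibWord.not_empty_edge_two (w : FibWord) : ¬ FibWord.empty.Edge (.two w) := by
  rintro (h | ⟨k, u, h, -⟩ | ⟨k, l, u, hl, hk, h, -⟩)
  · cases h
  · cases k <;> simp [Function.iterate_succ_apply'] at h
  · obtain ⟨k, rfl⟩ := Nat.exists_eq_add_of_le' (hl.trans hk)
    simp [Function.iterate_succ_apply'] at h

theorem FibWord.one_edge_two_iff {v w : FibWord} : (FibWord.one v).Edge (.two w) ↔ v = w := by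
  constructor
  · rintro (h | ⟨k, u, h, h'⟩ | ⟨k, l, u, hl, hk, h, -⟩)
    · cases h
    · cases k with
      | zero => simp_all
      | succ k => simp [Function.iterate_succ_apply'] at h
    · obtain ⟨k, rfl⟩ := Nat.exists_eq_add_of_le' (hl.trans hk)
      simp [Function.iterate_succ_apply'] at h
  · rintro rfl
    exact .inr (.inl ⟨0, v, rfl, rfl⟩)

theorem FibWord.two_edge_two_iff {v w : FibWord} :
    (FibWord.two v).Edge (.two w) ↔ v.Edge w := by
  constructor
  · rintro (h | ⟨k, u, h, h'⟩ | ⟨k, l, u, hl, hk, h, h'⟩)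
    · cases h
    · cases k with
      | zero => simp at h
      | succ k =>
        rw [Function.iterate_succ_apply'] at h h'
        exact .inr (.inl ⟨k, u, FibWord.two.inj h, FibWord.two.inj h'⟩)
    · obtain ⟨k, rfl⟩ := Nat.exists_eq_add_of_le' (hl.trans hk)
      obtain ⟨l, rfl⟩ := Nat.exists_eq_add_of_le' hl
      rw [Function.iterate_succ_apply'] at h h'
      rw [Nat.add_sub_add_right] at h'
      have h := FibWord.two.inj h
      have h' := FibWord.two.inj h'
      -- Stripping the leading `2` shifts `k` and `l` down by one; the original `l = 1` becomes an
      -- edge `v ↗ 1v`, of the first kind.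
      cases l with
      | zero => exact .inl (by simpa [h] using h')
      | succ l => exact .inr (.inr ⟨k, l + 1, u, by omega, by omega, h, h'⟩)
  · rintro (rfl | ⟨k, u, rfl, rfl⟩ | ⟨k, l, u, hl, hk, rfl, rfl⟩)
    · exact .inr (.inr ⟨1, 1, v, le_rfl, le_rfl, rfl, rfl⟩)
    · refine .inr (.inl ⟨k + 1, u, ?_, ?_⟩) <;> rw [← Function.iterate_succ_apply' two]
    · refine .inr (.inr ⟨k + 1, l + 1, u, by omega, by omega, ?_, ?_⟩) <;>
        rw [Function.iterate_succ_apply' two]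
      rw [Nat.add_sub_add_right]

theorem FibWord.Edge.weight_eq : ∀ {v w : FibWord}, v.Edge w → w.weight = v.weight + 1
  | v, .empty, h => (not_edge_empty v h).elim
  | v, .one w, h => by rw [edge_one_iff.1 h]; rfl
  | .empty, .two w, h => (not_empty_edge_two w h).elim
  | .one v, .two w, h => by rw [one_edge_two_iff.1 h]; rfl
  | .two v, .two w, h => by
    simp only [weight]
    rw [(two_edge_two_iff.1 h).weight_eq]

/-- The elements covered by `2v` are the elements that cover `v`. -/
theorem FibWord.edge_two_iff : ∀ {v w : FibWord}, w.Edge (.two v) ↔ v.Edge w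
  | v, .empty => iff_of_false (not_empty_edge_two v) (not_edge_empty v)
  | v, .one w => by rw [one_edge_two_iff, edge_one_iff, eq_comm]
  | .empty, .two w => by
    rw [two_edge_two_iff]
    exact iff_of_false (not_edge_empty w) (not_empty_edge_two w)
  | .one v, .two w => by rw [two_edge_two_iff, one_edge_two_iff, edge_one_iff, eq_comm]
  | .two v, .two w => by rw [two_edge_two_iff, two_edge_two_iff, edge_two_iff]

/-- Prefixing the letter `2`, as an embedding. -/
def FibWord.twoEmbedding : FibWord ↪ FibWord where
  toFun := .two
  inj' _ _ := FibWord.two.inj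

@[simp]
theorem FibWord.twoEmbedding_apply (v : FibWord) : twoEmbedding v = .two v := rfl

/-- The finite set of the elements that cover a Fibonacci word. -/
def FibWord.covers : FibWord → Finset FibWord
  | .empty => {.one .empty}
  | .one v => Finset.cons (.one (.one v)) {.two v} (by simp)
  | .two v => Finset.cons (.one (.two v)) (v.covers.map twoEmbedding)
      (by simp)

theorem FibWord.mem_covers : ∀ {v w : FibWord}, w ∈ v.covers ↔ v.Edge w
  | v, .empty => by
    cases v <;> simp [covers, not_edge_empty]
  | v, .one w => by
    cases v <;> simp [covers, edge_one_iff, eq_comm]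
  | .empty, .two w => by simp [covers, not_empty_edge_two]
  | .one v, .two w => by simp [covers, one_edge_two_iff, eq_comm]
  | .two v, .two w => by simp [covers, two_edge_two_iff, mem_covers]

/-! ### Dimensions -/

instance : Unique (SaturatedChain .empty) where
  default := .start
  uniq
    | .start => rfl
    | .extend (v := v) _ h => (not_edge_empty v h).elim

/-- A saturated chain to `1v` is a saturated chain to `v` with one more step. -/
def SaturatedChain.oneEquiv (v : FibWord) : SaturatedChain (.one v) ≃ SaturatedChain v where
  toFun
    | .extend c h => edge_one_iff.1 h ▸ c
  invFun c := .extend c (edge_one_iff.2 rfl)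
  left_inv
    | .extend c h => by
      obtain rfl := edge_one_iff.1 h
      rfl
  right_inv _ := rfl

/-- A saturated chain to `2v` is a saturated chain to an element that covers `v`, with one more
step. -/
def SaturatedChain.twoEquiv (v : FibWord) :
    SaturatedChain (.two v) ≃ Σ u : v.covers, SaturatedChain u.1 where
  toFun
    | .extend (v := u) c h => ⟨⟨u, mem_covers.2 (edge_two_iff.1 h)⟩, c⟩
  invFun c := .extend c.2 (edge_two_iff.2 (mem_covers.1 c.1.2))
  left_inv
    | .extend _ _ => rfl
  right_inv _ := rfl

/-- Needed because `Nat.card` is `0` on infinite types. The induction is on weight: a chain to `2v`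
passes through a cover of `v`, which has weight `|v| + 1`. -/
instance SaturatedChain.finite (w : FibWord) : Finite (SaturatedChain w) := by
  induction h : w.weight using Nat.strong_induction_on generalizing w with
  | _ n ih =>
    subst h
    cases w with
    | empty => infer_instance
    | one v =>
      have := ih v.weight (by simp [weight]) v rfl
      exact .of_equiv _ (SaturatedChain.oneEquiv v).symm
    | two v =>
      have (u : v.covers) : Finite (SaturatedChain u.1) :=
        ih u.1.weight (by rw [(mem_covers.1 u.2).weight_eq]; simp [weight]) u.1 rfl
      exact .of_equiv _ (SaturatedChain.twoEquiv v).symm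

theorem dim_empty : dim .empty = 1 := Nat.card_unique

theorem dim_one (v : FibWord) : dim (.one v) = dim v :=
  Nat.card_congr (SaturatedChain.oneEquiv v)

theorem dim_two_eq_sum (v : FibWord) : dim (.two v) = ∑ u ∈ v.covers, dim u := by
  rw [dim, Nat.card_congr (SaturatedChain.twoEquiv v), Nat.card_sigma,
    ← Finset.sum_coe_sort v.covers dim]
  rfl

/-- This is the differential poset property. The covers of `2v` are `12v` and the words `2u` with
`u` covering `v`; by induction the latter contribute `|v| + 2` times the sum of `dim u`, which is
`dim (2v)` again, and `12v` contributes one more copy. -/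
theorem dim_two (v : FibWord) : dim (.two v) = (v.weight + 1) * dim v := by
  induction h : v.weight using Nat.strong_induction_on generalizing v with
  | _ n ih =>
    subst h
    rw [dim_two_eq_sum]
    cases v with
    | empty => simp [covers, dim_one, weight]
    | one v =>
      simp only [covers, Finset.sum_cons, Finset.sum_singleton, dim_one, weight]
      rw [ih v.weight (by simp [weight]) v rfl]
      ring
    | two v =>
      simp only [covers, Finset.sum_cons, Finset.sum_map, twoEmbedding_apply, dim_one]
      have h : ∀ u ∈ v.covers, dim (.two u) = (v.weight + 2) * dim u := by
        intro u hu
        have hw := (mem_covers.1 hu).weight_eq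
        rw [ih u.weight (by rw [hw]; simp [weight]) u rfl, hw]
      rw [Finset.sum_congr rfl h, ← Finset.mul_sum, ← dim_two_eq_sum]
      simp only [weight]
      ring

theorem dim_pos (w : FibWord) : 0 < dim w := by
  induction w with
  | empty => simp [dim_empty]
  | one v ih => rwa [dim_one]
  | two v ih => rw [dim_two]; positivity

/-! ### Chain weights for the Plancherel harmonic function -/

/-- For `w = 2u` the quotient of factorials is `1 / (|u| + 1)`, which `dim_two` absorbs into `dim
w`; for `w = 1v` both sides are `1`. -/
theorem cotransition_plancherel {v w : FibWord} (h : v.Edge w) :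
    cotransition plancherel w v = (dim v : ℝ) / dim w := by
  have hv : (dim v : ℝ) ≠ 0 := by exact_mod_cast (dim_pos v).ne'
  cases w with
  | empty => exact (not_edge_empty v h).elim
  | one u =>
    obtain rfl := edge_one_iff.1 h
    simp [cotransition, h, dim_one, hv]
  | two u =>
    have hu : (dim u : ℝ) ≠ 0 := by exact_mod_cast (dim_pos u).ne'
    have hw := (edge_two_iff.1 h).weight_eq
    have hf : ((u.weight).factorial : ℝ) ≠ 0 := by positivity
    simp only [cotransition, if_pos h, plancherel, hw, dim_two, Nat.factorial_succ]
    push_cast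
    field_simp

/-- Bumping passes through columns of height two without changing them, until it creates a column of
height one or raises one to height two. No standardness of the tableau is needed. -/
theorem edge_shape_bump : ∀ (a : ℕ) (T : List Column), (shape T).Edge (shape (bump a T))
  | a, [] => .inl rfl
  | a, .single b :: T => by
    rw [bump]
    split_ifs
    · exact one_edge_two_iff.2 rfl
    · exact .inl rfl
  | a, .double b c :: T => by
    rw [bump]
    split_ifs
    · exact two_edge_two_iff.2 (edge_shape_bump c T)
    · exact .inl rfl

theorem edge_shape_eliminate {T : List Column} (hT : T ≠ []) :
    (shape (eliminate T)).Edge (shape T) := by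
  match T with
  | .single _ :: T => exact .inl rfl
  | .double _ a :: T => exact edge_two_iff.2 (edge_shape_bump a T)

theorem chainWeight_plancherel (T : List Column) : chainWeight plancherel T = 1 / dim (shape T) := by
  induction h : (shape T).weight generalizing T with
  | zero =>
    cases T with
    | nil => simp [chainWeight, shape, weight, dim_empty]
    | cons c T => cases c <;> simp [shape, weight] at h
  | succ n ih =>
    have hT : T ≠ [] := by rintro rfl; simp [shape, weight] at h
    have he := edge_shape_eliminate hT
    have hn : (shape (eliminate T)).weight = n := by have := he.weight_eq; omega
    have hd : (dim (shape (eliminate T)) : ℝ) ≠ 0 := by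
      exact_mod_cast (dim_pos (shape (eliminate T))).ne'
    have := ih _ hn
    rw [chainWeight, hn] at this
    -- Peeling off the first elimination leaves the chain weight of `eliminate T`.
    rw [chainWeight, h, Finset.prod_range_succ']
    simp only [Function.iterate_succ_apply, Function.iterate_zero, id] at this ⊢
    rw [this, cotransition_plancherel he]
    field_simp

/-! ### Banded Hessenberg determinants -/

section Hessenberg

variable {R : Type*} [CommRing R]

/-- Expansion along the last row of a matrix whose last row vanishes except for its last two
entries, the first of which is `1`. The last column is `c`. -/
theorem det_lastColumn_succ (a : ℕ → ℕ → R) (h1 : ∀ j, a (j + 1) j = 1)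
    (h0 : ∀ i j, j + 1 < i → a i j = 0) (c : ℕ → R) (n : ℕ) :
    (Matrix.of fun i j : Fin (n + 2) => if (j : ℕ) = n + 1 then c i else a i j).det =
      c (n + 1) * (Matrix.of fun i j : Fin (n + 1) => a i j).det -
        (Matrix.of fun i j : Fin (n + 1) => if (j : ℕ) = n then c i else a i j).det := by
  rw [Matrix.det_succ_row _ (Fin.last (n + 1)), Fin.sum_univ_castSucc, Fin.sum_univ_castSucc]
  rw [Finset.sum_eq_zero]
  · have e1 : (Matrix.of fun i j : Fin (n + 2) => if (j : ℕ) = n + 1 then c i else a i j).submatrix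
        (Fin.last (n + 1)).succAbove (Fin.last (n + 1)).succAbove =
        Matrix.of fun i j : Fin (n + 1) => a i j := by
      ext i j
      simp [Fin.succAbove_last, j.isLt.ne]
    have e2 : (Matrix.of fun i j : Fin (n + 2) => if (j : ℕ) = n + 1 then c i else a i j).submatrix
        (Fin.last (n + 1)).succAbove (Fin.last n).castSucc.succAbove =
        Matrix.of fun i j : Fin (n + 1) => if (j : ℕ) = n then c i else a i j := by
      ext i j
      refine Fin.lastCases ?_ (fun j => ?_) j
      · simp [Fin.succAbove_last]
      · have : (Fin.last n).castSucc.succAbove j.castSucc = j.castSucc.castSucc :=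
          Fin.succAbove_of_castSucc_lt _ _ (by simp [Fin.lt_def])
        have h := j.isLt
        simp [Fin.succAbove_last, this, h.ne, (h.trans (Nat.lt_succ_self n)).ne]
    rw [e1, e2]
    have s1 : ((-1 : R)) ^ (n + 1 + n) = -1 := Odd.neg_one_pow ⟨n, by ring⟩
    have s2 : ((-1 : R)) ^ (n + 1 + (n + 1)) = 1 := Even.neg_one_pow ⟨n + 1, by ring⟩
    simp [h1, s1, s2]
    ring
  · intro j _
    have h := j.isLt
    have : a (n + 1) j = 0 := h0 _ _ (by omega)
    simp [this, (h.trans (Nat.lt_succ_self n)).ne]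

theorem det_lastColumn_of_forall_lt (a : ℕ → ℕ → R) (c : ℕ → R) (n : ℕ)
    (hc : ∀ i < n, c i = 0) :
    (Matrix.of fun i j : Fin (n + 1) => if (j : ℕ) = n then c i else a i j).det =
      c n * (Matrix.of fun i j : Fin n => a i j).det := by
  rw [Matrix.det_succ_column _ (Fin.last n), Fin.sum_univ_castSucc, Finset.sum_eq_zero]
  · have e1 : (Matrix.of fun i j : Fin (n + 1) => if (j : ℕ) = n then c i else a i j).submatrix
        (Fin.last n).succAbove (Fin.last n).succAbove =
        Matrix.of fun i j : Fin n => a i j := by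
      ext i j
      simp [Fin.succAbove_last, j.isLt.ne]
    rw [e1]
    simp [Even.neg_one_pow (⟨n, rfl⟩ : Even (n + n))]
  · intro j _
    simp [hc j j.isLt]

/-- Singles out the last column so that the expansion can be iterated: deleting the last row and the
penultimate column gives a matrix of the same kind, with the same column truncated. -/
theorem det_eq_lastColumn (a : ℕ → ℕ → R) (n : ℕ) :
    (Matrix.of fun i j : Fin (n + 1) => a i j).det =
      (Matrix.of fun i j : Fin (n + 1) => if (j : ℕ) = n then a i n else a i j).det := by
  congr 2
  ext i j
  split_ifs with h
  · rw [h]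
  · rfl

theorem det_tridiagonal_succ_succ (a : ℕ → ℕ → R) (h1 : ∀ j, a (j + 1) j = 1)
    (h0 : ∀ i j, j + 1 < i → a i j = 0) (hb : ∀ i j, i + 1 < j → a i j = 0) (n : ℕ) :
    (Matrix.of fun i j : Fin (n + 2) => a i j).det =
      a (n + 1) (n + 1) * (Matrix.of fun i j : Fin (n + 1) => a i j).det -
        a n (n + 1) * (Matrix.of fun i j : Fin n => a i j).det := by
  rw [det_eq_lastColumn, det_lastColumn_succ a h1 h0 (fun i => a i (n + 1)),
    det_lastColumn_of_forall_lt a (fun i => a i (n + 1)) n fun i hi => hb _ _ (by omega)]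

theorem det_quadridiagonal_add_three (a : ℕ → ℕ → R) (h1 : ∀ j, a (j + 1) j = 1)
    (h0 : ∀ i j, j + 1 < i → a i j = 0) (hb : ∀ i j, i + 2 < j → a i j = 0) (n : ℕ) :
    (Matrix.of fun i j : Fin (n + 3) => a i j).det =
      a (n + 2) (n + 2) * (Matrix.of fun i j : Fin (n + 2) => a i j).det -
        a (n + 1) (n + 2) * (Matrix.of fun i j : Fin (n + 1) => a i j).det +
        a n (n + 2) * (Matrix.of fun i j : Fin n => a i j).det := by
  rw [det_eq_lastColumn, det_lastColumn_succ a h1 h0 (fun i => a i (n + 2)),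
    det_lastColumn_succ a h1 h0 (fun i => a i (n + 2)),
    det_lastColumn_of_forall_lt a (fun i => a i (n + 2)) n fun i hi => hb _ _ (by omega)]
  ring

/-! ### Recurrences for clone Schur functions -/

variable (x y : ℕ → R)

theorem detA_zero : detA x y 0 = 1 := Matrix.det_isEmpty

theorem detA_one : detA x y 1 = x 1 := by simp [detA]

theorem detA_add_two (n : ℕ) :
    detA x y (n + 2) = x (n + 2) * detA x y (n + 1) - y (n + 1) * detA x y n := by
  refine (det_tridiagonal_succ_succ (fun i j => if j = i then x (i + 1)
    else if j = i + 1 then y (i + 1) else if i = j + 1 then 1 else 0) ?_ ?_ ?_ n).trans ?_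
  · intro j
    rw [if_neg (by omega), if_neg (by omega), if_pos rfl]
  · intro i j h
    rw [if_neg (by omega), if_neg (by omega), if_neg (by omega)]
  · intro i j h
    rw [if_neg (by omega), if_neg (by omega), if_neg (by omega)]
  · simp [detA]

theorem detB_zero : detB x y 0 = y 1 := by simp [detB]

theorem detB_one : detB x y 1 = y 1 * x 3 - x 1 * y 2 := by
  simp [detB, Matrix.det_fin_two]

theorem detB_add_two (n : ℕ) :
    detB x y (n + 2) = x (n + 4) * detB x y (n + 1) - y (n + 3) * detB x y n := by
  refine (det_tridiagonal_succ_succ (fun i j => if j = i then (if i = 0 then y 1 else x (i + 2))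
    else if j = i + 1 then (if i = 0 then x 1 * y 2 else y (i + 2))
    -- `B_k` has size `k + 1`; the shift by one also keeps the recurrence away from the exceptional
    -- first row.
    else if i = j + 1 then 1 else 0) ?_ ?_ ?_ (n + 1)).trans ?_
  · intro j
    rw [if_neg (by omega), if_neg (by omega), if_pos rfl]
  · intro i j h
    rw [if_neg (by omega), if_neg (by omega), if_neg (by omega)]
  · intro i j h
    rw [if_neg (by omega), if_neg (by omega), if_neg (by omega)]
  · simp [detB]

/-- The determinants `A` and shifted `B` satisfy the same recurrence in the number of leading `1`s,
and its coefficients depend only on the total weight. They can therefore be pulled out of sums over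
words of fixed weight. -/
theorem cloneSchurAux_add_two (k : ℕ) (w : FibWord) :
    cloneSchurAux x y (k + 2) w = x (w.weight + k + 2) * cloneSchurAux x y (k + 1) w -
      y (w.weight + k + 1) * cloneSchurAux x y k w := by
  induction w generalizing k with
  | empty => simp [cloneSchurAux, detA_add_two, weight]
  | one v ih =>
    simp only [cloneSchurAux, weight]
    rw [show k + 2 + 1 = k + 1 + 2 from rfl, ih]
    congr 3 <;> congr 1 <;> ring
  | two u ih =>
    simp only [cloneSchurAux, weight, detB_add_two, shift]
    rw [show u.weight + 2 + k + 2 = k + 4 + u.weight by ring,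
      show u.weight + 2 + k + 1 = k + 3 + u.weight by ring]
    ring

/-! ### The quadridiagonal determinant. -/

theorem quadridiagonal_det_zero (τ : R) : (quadridiagonal x y τ 0).det = 1 := Matrix.det_isEmpty

theorem quadridiagonal_det_one (τ : R) : (quadridiagonal x y τ 1).det = x 1 := by
  simp [quadridiagonal]

theorem quadridiagonal_det_two (τ : R) :
    (quadridiagonal x y τ 2).det = x 1 * x 2 - (1 - τ) * y 1 := by
  simp [quadridiagonal, Matrix.det_fin_two]

theorem quadridiagonal_det_add_three (τ : R) (n : ℕ) :
    (quadridiagonal x y τ (n + 3)).det = x (n + 3) * (quadridiagonal x y τ (n + 2)).det -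
      (1 - (n + 2) * τ) * y (n + 2) * (quadridiagonal x y τ (n + 1)).det -
      (n + 1) * τ * x (n + 1) * y (n + 2) * (quadridiagonal x y τ n).det := by
  refine (det_quadridiagonal_add_three (fun i j => if j = i then x (i + 1)
    else if j = i + 1 then (1 - ((i + 1 : ℕ) : R) * τ) * y (i + 1)
    else if j = i + 2 then -((i + 1 : ℕ) : R) * τ * x (i + 1) * y (i + 2)
    else if i = j + 1 then 1 else 0) ?_ ?_ ?_ n).trans ?_
  · intro j
    simp [show j ≠ j + 1 + 1 by omega, show j ≠ j + 1 + 2 by omega]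
  · intro i j h
    rw [if_neg (by omega), if_neg (by omega), if_neg (by omega), if_neg (by omega)]
  · intro i j h
    rw [if_neg (by omega), if_neg (by omega), if_neg (by omega), if_neg (by omega)]
  · simp only [quadridiagonal]
    simp
    ring

end Hessenberg

/-! ### Weighted sums over Fibonacci words -/

/-- The sum of `dim w * τ ^ (number of letters 2 in w) * f w` over the words of weight `n`, given
by its recursion in `n`. -/
def wordSum {R : Type*} [CommRing R] (τ : R) : ℕ → (FibWord → R) → R
  | 0, f => f .empty
  | 1, f => f (.one .empty)
  | n + 2, f => wordSum τ (n + 1) (fun w => f (.one w)) +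
      (n + 1) * τ * wordSum τ n (fun w => f (.two w))

section WordSum

variable {R S : Type*} [CommRing R] [CommRing S]

/-- In this form `n` counts the partners of the largest point and `n - 1` the points left over. For
`n = 0` the truncated subtraction is harmless, since the coefficient vanishes. -/
theorem wordSum_succ (τ : S) (n : ℕ) (f : FibWord → S) :
    wordSum τ (n + 1) f = wordSum τ n (fun w => f (.one w)) +
      n * τ * wordSum τ (n - 1) (fun w => f (.two w)) := by
  cases n with
  | zero => simp [wordSum]
  | succ n => simp [wordSum]

theorem wordSum_congr (τ : S) {n : ℕ} {f g : FibWord → S} (h : ∀ w, w.weight = n → f w = g w) :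
    wordSum τ n f = wordSum τ n g := by
  induction n using Nat.strong_induction_on generalizing f g with
  | _ n ih =>
    match n with
    | 0 => exact h _ rfl
    | 1 => exact h _ rfl
    | n + 2 =>
      rw [wordSum, wordSum, ih (n + 1) (by omega) fun w hw => h _ (by simp [weight, hw]),
        ih n (by omega) fun w hw => h _ (by simp [weight, hw])]

theorem wordSum_mul_left (τ c : S) (n : ℕ) (f : FibWord → S) :
    wordSum τ n (fun w => c * f w) = c * wordSum τ n f := by
  induction n using Nat.strong_induction_on generalizing f with
  | _ n ih =>
    match n with
    | 0 => rfl
    | 1 => rfl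
    | n + 2 =>
      rw [wordSum, wordSum, ih (n + 1) (by omega), ih n (by omega)]
      ring

theorem wordSum_sub (τ : S) (n : ℕ) (f g : FibWord → S) :
    wordSum τ n (fun w => f w - g w) = wordSum τ n f - wordSum τ n g := by
  induction n using Nat.strong_induction_on generalizing f g with
  | _ n ih =>
    match n with
    | 0 => rfl
    | 1 => rfl
    | n + 2 =>
      rw [wordSum, wordSum, wordSum, ih (n + 1) (by omega), ih n (by omega)]
      ring

/-! ### Weighted sums of clone Schur functions, pushed along a ring map so as to cover real and
complex `τ`. -/

variable (g : R →+* S) (x y : ℕ → R) (τ : S)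

theorem wordSum_cloneSchurAux_add_two (n k : ℕ) :
    wordSum τ n (fun w => g (cloneSchurAux x y (k + 2) w)) =
      g (x (n + k + 2)) * wordSum τ n (fun w => g (cloneSchurAux x y (k + 1) w)) -
      g (y (n + k + 1)) * wordSum τ n (fun w => g (cloneSchurAux x y k w)) := by
  rw [← wordSum_mul_left, ← wordSum_mul_left, ← wordSum_sub]
  refine wordSum_congr τ fun w hw => ?_
  rw [cloneSchurAux_add_two, map_sub, map_mul, map_mul, hw]

theorem wordSum_cloneSchurAux_succ_succ (n k : ℕ) :
    wordSum τ (n + 2) (fun w => g (cloneSchurAux x y k w)) =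
      wordSum τ (n + 1) (fun w => g (cloneSchurAux x y (k + 1) w)) +
      (n + 1) * τ * g (detB (shift x n) (shift y n) k) *
        wordSum τ n (fun w => g (cloneSchur x y w)) := by
  rw [wordSum, mul_assoc _ (g _), ← wordSum_mul_left τ (g _)]
  refine congrArg _ (congrArg _ (wordSum_congr τ fun w hw => ?_))
  rw [cloneSchurAux, map_mul, hw, cloneSchur]

theorem wordSum_cloneSchur_add_three (n : ℕ) :
    wordSum τ (n + 3) (fun w => g (cloneSchur x y w)) =
      g (x (n + 3)) * wordSum τ (n + 2) (fun w => g (cloneSchur x y w)) -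
      (1 - (n + 2) * τ) * g (y (n + 2)) * wordSum τ (n + 1) (fun w => g (cloneSchur x y w)) -
      (n + 1) * τ * g (x (n + 1)) * g (y (n + 2)) *
        wordSum τ n (fun w => g (cloneSchur x y w)) := by
  have h1 := wordSum_cloneSchurAux_succ_succ g x y τ (n + 1) 0
  have h2 := wordSum_cloneSchurAux_succ_succ g x y τ n 1
  have h3 := wordSum_cloneSchurAux_add_two g x y τ (n + 1) 0
  have h4 := wordSum_cloneSchurAux_succ_succ g x y τ n 0
  simp only [detB_zero, detB_one, shift, map_sub, map_mul, zero_add] at h1 h2 h3 h4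
  simp only [show 1 + (n + 1) = n + 2 by ring, show 1 + n = n + 1 by ring,
    show 2 + n = n + 2 by ring, show 3 + n = n + 3 by ring,
    show n + 1 + 0 + 2 = n + 3 by ring, show n + 1 + 0 + 1 = n + 2 by ring,
    Nat.cast_add,
    Nat.cast_one] at h1 h2 h3 h4
  simp only [cloneSchur] at h1 h2 h3 h4 ⊢
  -- `h1` and `h2` split off the first and second letters, `h3` removes the prefix `11`, and `h4`
  -- eliminates the remaining sum over words `1w`. The `y (n + 1)` part of `B₁` cancels.
  linear_combination h1 + h2 + h3 - g (x (n + 3)) * h4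

theorem wordSum_cloneSchur_zero : wordSum τ 0 (fun w => g (cloneSchur x y w)) = 1 := by
  simp [wordSum, cloneSchur, cloneSchurAux, detA_zero]

theorem wordSum_cloneSchur_one : wordSum τ 1 (fun w => g (cloneSchur x y w)) = g (x 1) := by
  simp [wordSum, cloneSchur, cloneSchurAux, detA_one]

theorem wordSum_cloneSchur_two : wordSum τ 2 (fun w => g (cloneSchur x y w)) =
    g (x 1) * g (x 2) - (1 - τ) * g (y 1) := by
  simp [wordSum, cloneSchur, cloneSchurAux, detA_add_two x y 0, detA_zero, detA_one, detB_zero,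
    shift, weight]
  ring

theorem wordSum_cloneSchur_eq_det (n : ℕ) : wordSum τ n (fun w => g (cloneSchur x y w)) =
    (quadridiagonal (fun k => g (x k)) (fun k => g (y k)) τ n).det := by
  induction n using Nat.strong_induction_on with
  | _ n ih =>
    match n with
    | 0 => rw [wordSum_cloneSchur_zero, quadridiagonal_det_zero]
    | 1 => rw [wordSum_cloneSchur_one, quadridiagonal_det_one]
    | 2 => rw [wordSum_cloneSchur_two, quadridiagonal_det_two]
    | n + 3 =>
      rw [wordSum_cloneSchur_add_three, quadridiagonal_det_add_three, ih (n + 2) (by omega),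
        ih (n + 1) (by omega), ih n (by omega)]

theorem wordSum_one_cloneSchur (n : ℕ) : wordSum 1 n (fun w => g (cloneSchur x y w)) =
    ∏ k ∈ Finset.Icc 1 n, g (x k) := by
  induction n using Nat.strong_induction_on with
  | _ n ih =>
    match n with
    | 0 => simp [wordSum_cloneSchur_zero]
    | 1 => simp [wordSum_cloneSchur_one]
    | 2 => simp [wordSum_cloneSchur_two, Finset.prod_Icc_succ_top]
    | n + 3 =>
      -- At `τ = 1` the two terms in `y (n + 2)` cancel, leaving only `x (n + 3)` times the previous
      -- product.
      rw [wordSum_cloneSchur_add_three, ih (n + 2) (by omega), ih (n + 1) (by omega),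
        ih n (by omega)]
      simp only [Finset.prod_Icc_succ_top (Nat.le_add_left 1 _)]
      ring

end WordSum

/-! ### Positivity -/

theorem weight_iterate_one_empty (n : ℕ) : (FibWord.one^[n] .empty).weight = n := by
  induction n with
  | zero => rfl
  | succ n ih => simp [Function.iterate_succ_apply', weight, ih]

/-- Compare `s_{21ⁿ} = y_{n+1} s_{1ⁿ}` with `s_{1ⁿ}`. -/
theorem FibonacciPositive.y_pos {x y : ℕ → ℝ} (h : FibonacciPositive x y) (n : ℕ) :
    0 < y (n + 1) := by
  have h1 := h (FibWord.one^[n] .empty)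
  have h2 := h (.two (FibWord.one^[n] .empty))
  have hw := weight_iterate_one_empty n
  rw [cloneSchur, cloneSchurAux, detB_zero, shift, hw] at h2
  rw [add_comm]
  exact pos_of_mul_pos_left h2 h1.le

/-- Positivity of `s_{121ⁿ}` gives `y_{n+1} x_{n+3} > x_{n+1} y_{n+2}`, so positivity passes from
`x_{n+1}` to `x_{n+3}`; `s_1` and `s_{11}` start the recursion. -/
theorem FibonacciPositive.x_pos {x y : ℕ → ℝ} (h : FibonacciPositive x y) :
    ∀ n : ℕ, 0 < x (n + 1)
  | 0 => by simpa [cloneSchur, cloneSchurAux, detA_one] using h (.one .empty)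
  | 1 => by
    have h1 : 0 < x 1 := by simpa [cloneSchur, cloneSchurAux, detA_one] using h (.one .empty)
    have h2 := h (.one (.one .empty))
    simp [cloneSchur, cloneSchurAux, detA_add_two x y 0, detA_zero, detA_one] at h2
    have := h.y_pos 0
    simp only [zero_add] at this
    exact pos_of_mul_pos_left (this.trans h2) h1.le
  | n + 2 => by
    have h1 := h (FibWord.one^[n] .empty)
    have h2 := h (.one (.two (FibWord.one^[n] .empty)))
    have hw := weight_iterate_one_empty n
    simp only [cloneSchur, cloneSchurAux, zero_add, detB_one, shift, hw] at h2
    have h3 := pos_of_mul_pos_left h2 h1.le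
    rw [show 3 + n = n + 2 + 1 by ring, show 1 + n = n + 1 by ring,
      show 2 + n = n + 1 + 1 by ring] at h3
    have h4 := mul_pos (h.x_pos n) (h.y_pos (n + 1))
    exact pos_of_mul_pos_right (by linarith) (h.y_pos n).le

/-! ### Insertion tableaux of involutions -/

theorem foldr_max_eq {a m : ℕ} {r : List ℕ} (hm : m ∈ a :: r) (h : ∀ b ∈ a :: r, b ≤ m) :
    r.foldr max a = m := by
  induction r generalizing m with
  | nil => simpa [eq_comm] using hm
  | cons b r ih =>
    rw [List.foldr_cons]
    refine le_antisymm (max_le (h b (by simp)) ?_) ?_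
    · have key : ∀ l : List ℕ, (∀ c ∈ a :: l, c ≤ m) → l.foldr max a ≤ m := by
        intro l hl
        induction l with
        | nil => exact hl a (by simp)
        | cons c l ihl =>
          exact max_le (hl c (by simp)) (ihl fun d hd => hl d (by simp at hd ⊢; tauto))
      exact key r fun c hc => h c (by simp at hc ⊢; tauto)
    · have key : ∀ l : List ℕ, ∀ c ∈ a :: l, c ≤ l.foldr max a := by
        intro l
        induction l with
        | nil => simp
        | cons d l ihl =>
          intro c hc
          rw [List.foldr_cons]
          simp only [List.mem_cons] at hc ihl
          rcases hc with rfl | rfl | hc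
          · exact (ihl _ (.inl rfl)).trans (le_max_right _ _)
          · exact le_max_left _ _
          · exact (ihl _ (.inr hc)).trans (le_max_right _ _)
      exact key (b :: r) m hm

theorem insertionTableau_cons_single {a : ℕ} {r : List ℕ} (h : ∀ b ∈ r, b ≤ a) :
    insertionTableau (a :: r) = .single a :: insertionTableau r := by
  rw [insertionTableau, foldr_max_eq (m := a) (by simp) (by simpa using h)]
  simp

theorem insertionTableau_cons_double {a m : ℕ} {r : List ℕ} (hm : m ∈ r) (ha : a < m)
    (h : ∀ b ∈ r, b ≤ m) :
    insertionTableau (a :: r) = .double m a :: insertionTableau (r.erase m) := by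
  rw [insertionTableau, foldr_max_eq (m := m) (by simp [hm]) (by simpa using ⟨ha.le, h⟩)]
  simp [ha.ne']

section Involutions

variable {N : ℕ}

/-- The involutions that fix all points outside of the list `l`. -/
def involutionsOn (l : List (Fin N)) : Finset (Equiv.Perm (Fin N)) :=
  Finset.univ.filter fun σ => σ * σ = 1 ∧ ∀ a, a ∉ l → σ a = a

theorem mem_involutionsOn {l : List (Fin N)} {σ : Equiv.Perm (Fin N)} :
    σ ∈ involutionsOn l ↔ (∀ a, σ (σ a) = a) ∧ ∀ a, a ∉ l → σ a = a := by
  simp [involutionsOn, Equiv.ext_iff]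

theorem apply_mem_of_mem_involutionsOn {l : List (Fin N)} {σ : Equiv.Perm (Fin N)}
    (h : σ ∈ involutionsOn l) {a : Fin N} (ha : a ∈ l) : σ a ∈ l := by
  rw [mem_involutionsOn] at h
  by_contra h'
  have := h.2 _ h'
  rw [h.1] at this
  exact h' (this ▸ ha)

/-- The shape of the insertion tableau of the word of `σ` at the positions in `l`. -/
def shapeOn (l : List (Fin N)) (σ : Equiv.Perm (Fin N)) : FibWord :=
  shape (insertionTableau (l.map fun i => (σ i : ℕ) + 1))

/-- Positions are listed decreasingly because words are read from the right. An involution preserves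
the set of listed positions, so the head `M` is also the largest value present. -/
theorem shapeOn_cons_of_fixed {M : Fin N} {t : List (Fin N)} (hl : (M :: t).Pairwise (· > ·))
    {σ : Equiv.Perm (Fin N)} (h : σ ∈ involutionsOn (M :: t)) (hM : σ M = M) :
    shapeOn (M :: t) σ = .one (shapeOn t σ) := by
  rw [shapeOn, List.map_cons, insertionTableau_cons_single]
  · rfl
  · intro b hb
    obtain ⟨i, hi, rfl⟩ := List.mem_map.1 hb
    have := apply_mem_of_mem_involutionsOn h (List.mem_cons_of_mem M hi)
    rw [hM]
    rcases List.mem_cons.1 this with e | e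
    · rw [e]
    · have := (List.pairwise_cons.1 hl).1 _ e
      rw [gt_iff_lt, Fin.lt_def] at this
      omega

/-- The largest remaining value is `M`, at position `σ M = j`. Erasing that value thus erases
position `j`: insertion pairs exactly the two-cycle of `M`. -/
theorem shapeOn_cons_of_mem {M j : Fin N} {t : List (Fin N)} (hl : (M :: t).Pairwise (· > ·))
    {σ : Equiv.Perm (Fin N)} (h : σ ∈ involutionsOn (M :: t)) (hj : j ∈ t) (hM : σ M = j) :
    shapeOn (M :: t) σ = .two (shapeOn (t.erase j) σ) := by
  have hjM : σ j = M := by rw [← hM, (mem_involutionsOn.1 h).1]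
  have hlt := (List.pairwise_cons.1 hl).1
  have hinj : Function.Injective fun i => (σ i : ℕ) + 1 := fun a b hab =>
    σ.injective (Fin.ext (Nat.succ.inj hab))
  rw [shapeOn, List.map_cons, insertionTableau_cons_double (m := (M : ℕ) + 1)]
  · rw [shape, shapeOn, List.map_erase hinj, hjM]
  · exact List.mem_map.2 ⟨j, hj, by rw [hjM]⟩
  · have := hlt j hj
    rw [gt_iff_lt, Fin.lt_def] at this
    rw [hM]
    omega
  · intro b hb
    obtain ⟨i, hi, rfl⟩ := List.mem_map.1 hb
    have := apply_mem_of_mem_involutionsOn h (List.mem_cons_of_mem M hi)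
    rcases List.mem_cons.1 this with e | e
    · rw [e]
    · have := hlt _ e
      rw [gt_iff_lt, Fin.lt_def] at this
      omega

/-! ### Removing the largest point of an involution. -/

theorem filter_fixed_involutionsOn (M : Fin N) (t : List (Fin N)) (hM : M ∉ t) :
    (involutionsOn (M :: t)).filter (fun σ => σ M = M) = involutionsOn t := by
  ext σ
  rw [Finset.mem_filter, mem_involutionsOn, mem_involutionsOn]
  constructor
  · rintro ⟨⟨h1, h2⟩, h3⟩
    refine ⟨h1, fun a ha => ?_⟩
    by_cases e : a = M
    · rw [e, h3]
    · exact h2 a (by simp [e, ha])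
  · rintro ⟨h1, h2⟩
    exact ⟨⟨h1, fun a ha => h2 a fun h => ha (List.mem_cons_of_mem _ h)⟩, h2 M hM⟩

theorem apply_eq_of_mem_involutionsOn_erase {M j : Fin N} {t : List (Fin N)} (hM : M ∉ t)
    (ht : t.Nodup) {σ : Equiv.Perm (Fin N)} (h : σ ∈ involutionsOn (t.erase j)) :
    σ M = M ∧ σ j = j := by
  rw [mem_involutionsOn] at h
  exact ⟨h.2 _ fun h' => hM (List.mem_of_mem_erase h'), h.2 _ ht.not_mem_erase⟩

theorem swap_mul_apply_of_ne {M j a : Fin N} {σ : Equiv.Perm (Fin N)} (hM : σ M = M)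
    (hj : σ j = j) (haM : a ≠ M) (haj : a ≠ j) : (Equiv.swap M j * σ) a = σ a := by
  rw [Equiv.Perm.mul_apply, Equiv.swap_apply_of_ne_of_ne]
  · exact fun h => haM (σ.injective (h.trans hM.symm))
  · exact fun h => haj (σ.injective (h.trans hj.symm))

theorem swap_mul_mem_involutionsOn {M j : Fin N} {t : List (Fin N)} (hM : M ∉ t)
    (ht : t.Nodup) (hj : j ∈ t) {σ : Equiv.Perm (Fin N)} (h : σ ∈ involutionsOn (t.erase j)) :
    Equiv.swap M j * σ ∈ involutionsOn (M :: t) ∧ (Equiv.swap M j * σ) M = j := by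
  obtain ⟨h1, h2⟩ := apply_eq_of_mem_involutionsOn_erase hM ht h
  have hσ := mem_involutionsOn.1 h
  have eM : (Equiv.swap M j * σ) M = j := by simp [h1]
  have ej : (Equiv.swap M j * σ) j = M := by simp [h2]
  refine ⟨mem_involutionsOn.2 ⟨fun a => ?_, fun a ha => ?_⟩, eM⟩
  · by_cases haM : a = M
    · rw [haM, eM, ej]
    by_cases haj : a = j
    · rw [haj, ej, eM]
    rw [swap_mul_apply_of_ne h1 h2 haM haj, swap_mul_apply_of_ne h1 h2, hσ.1]
    · exact fun h => haM (σ.injective (h.trans h1.symm))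
    · exact fun h => haj (σ.injective (h.trans h2.symm))
  · rw [List.mem_cons, not_or] at ha
    rw [swap_mul_apply_of_ne h1 h2 ha.1 fun h => ha.2 (h ▸ hj)]
    exact hσ.2 a fun h => ha.2 (List.mem_of_mem_erase h)

theorem swap_mul_mem_involutionsOn_erase {M j : Fin N} {t : List (Fin N)}
    {σ : Equiv.Perm (Fin N)} (h : σ ∈ involutionsOn (M :: t)) (hσj : σ M = j) :
    Equiv.swap M j * σ ∈ involutionsOn (t.erase j) := by
  have hσ := mem_involutionsOn.1 h
  have hσM : σ j = M := by rw [← hσj, hσ.1]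
  have eM : (Equiv.swap M j * σ) M = M := by simp [hσj]
  have ej : (Equiv.swap M j * σ) j = j := by simp [hσM]
  have e : ∀ a, a ≠ M → a ≠ j → (Equiv.swap M j * σ) a = σ a := by
    intro a haM haj
    rw [Equiv.Perm.mul_apply, Equiv.swap_apply_of_ne_of_ne]
    · exact fun h => haj (σ.injective (h.trans hσM.symm))
    · exact fun h => haM (σ.injective (h.trans hσj.symm))
  refine mem_involutionsOn.2 ⟨fun a => ?_, fun a ha => ?_⟩
  · by_cases haM : a = M
    · rw [haM, eM, eM]
    by_cases haj : a = j
    · rw [haj, ej, ej]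
    rw [e a haM haj, e, hσ.1]
    · exact fun h => haj (σ.injective (h.trans hσM.symm))
    · exact fun h => haM (σ.injective (h.trans hσj.symm))
  · by_cases haM : a = M
    · rw [haM, eM]
    by_cases haj : a = j
    · rw [haj, ej]
    rw [e a haM haj]
    refine hσ.2 a fun h => ha ?_
    exact (List.mem_erase_of_ne haj).2 ((List.mem_cons.1 h).resolve_left haM)

theorem count_two_cycleType_swap_mul {M j : Fin N} (hMj : M ≠ j) {σ : Equiv.Perm (Fin N)}
    (hM : σ M = M) (hj : σ j = j) :
    (Equiv.swap M j * σ).cycleType.count 2 = σ.cycleType.count 2 + 1 := by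
  have hd : (Equiv.swap M j).Disjoint σ := by
    intro a
    by_cases haM : a = M
    · exact .inr (haM ▸ hM)
    by_cases haj : a = j
    · exact .inr (haj ▸ hj)
    exact .inl (Equiv.swap_apply_of_ne_of_ne haM haj)
  rw [hd.cycleType_mul, (Equiv.Perm.swap_isSwap_iff.2 hMj).isCycle.cycleType,
    Equiv.Perm.card_support_swap hMj, Multiset.count_add]
  simp [add_comm]

theorem shapeOn_swap_mul {M j : Fin N} {t : List (Fin N)} (hM : M ∉ t) (ht : t.Nodup)
    {σ : Equiv.Perm (Fin N)} (h : σ ∈ involutionsOn (t.erase j)) :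
    shapeOn (t.erase j) (Equiv.swap M j * σ) = shapeOn (t.erase j) σ := by
  obtain ⟨h1, h2⟩ := apply_eq_of_mem_involutionsOn_erase hM ht h
  rw [shapeOn, shapeOn]
  congr 2
  refine List.map_congr_left fun a ha => ?_
  rw [swap_mul_apply_of_ne h1 h2]
  · rintro rfl
    exact hM (List.mem_of_mem_erase ha)
  · rintro rfl
    exact ht.not_mem_erase ha

/-- Induction on the set of positions, splitting by `σ M` for the largest position `M`. Staying
inside one symmetric group and shrinking the list avoids relabelling smaller permutations. -/
theorem sum_involutionsOn {S : Type*} [CommRing S] (τ : S) (l : List (Fin N))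
    (hl : l.Pairwise (· > ·)) (f : FibWord → S) :
    ∑ σ ∈ involutionsOn l, f (shapeOn l σ) * τ ^ σ.cycleType.count 2 =
      wordSum τ l.length f := by
  induction h : l.length using Nat.strong_induction_on generalizing l f with
  | _ n ih =>
    subst h
    cases l with
    | nil =>
      have : involutionsOn ([] : List (Fin N)) = {1} := by
        ext σ
        rw [mem_involutionsOn, Finset.mem_singleton, Equiv.ext_iff]
        constructor
        · exact fun h a => h.2 a (by simp)
        · exact fun h => ⟨fun a => by simp [h], fun a _ => h a⟩
      rw [this]
      simp [shapeOn, insertionTableau, shape, wordSum]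
    | cons M t =>
      have hlt := (List.pairwise_cons.1 hl).1
      have htp := (List.pairwise_cons.1 hl).2
      have ht : t.Nodup := htp.imp fun h => ne_of_gt h
      have hM : M ∉ t := fun h => (hlt M h).false
      rw [← Finset.sum_fiberwise_of_maps_to (t := insert M t.toFinset) (g := fun σ => σ M)
        fun σ hσ => by simpa using apply_mem_of_mem_involutionsOn hσ List.mem_cons_self]
      rw [Finset.sum_insert (by simpa using hM), List.length_cons, wordSum_succ]
      congr 1
      · rw [← ih t.length (by simp) t htp _ rfl, filter_fixed_involutionsOn M t hM]
        refine Finset.sum_congr rfl fun σ hσ => ?_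
        rw [← filter_fixed_involutionsOn M t hM, Finset.mem_filter] at hσ
        rw [shapeOn_cons_of_fixed hl hσ.1 hσ.2]
      · have key : ∀ j ∈ t.toFinset, ∑ σ ∈ involutionsOn (M :: t) with σ M = j,
            f (shapeOn (M :: t) σ) * τ ^ σ.cycleType.count 2 =
            τ * wordSum τ (t.length - 1) (fun w => f (.two w)) := by
          intro j hj
          rw [List.mem_toFinset] at hj
          rw [← ih (t.length - 1) (by simp) (t.erase j)
            (htp.sublist List.erase_sublist) _ (List.length_erase_of_mem hj), Finset.mul_sum]
          -- Multiplication by the transposition `(M j)` is its own inverse; it removes the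
          -- two-cycle of `M`, which accounts for one factor `τ`.
          refine Finset.sum_bij' (fun σ _ => Equiv.swap M j * σ) (fun σ _ => Equiv.swap M j * σ)
            ?_ ?_ ?_ ?_ ?_
          · intro σ hσ
            rw [Finset.mem_filter] at hσ
            exact swap_mul_mem_involutionsOn_erase hσ.1 hσ.2
          · intro σ hσ
            exact Finset.mem_filter.2 (swap_mul_mem_involutionsOn hM ht hj hσ)
          · intro σ _
            simp
          · intro σ _
            simp
          · intro σ hσ
            rw [Finset.mem_filter] at hσ
            have hρ := swap_mul_mem_involutionsOn_erase hσ.1 hσ.2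
            obtain ⟨e1, e2⟩ := apply_eq_of_mem_involutionsOn_erase hM ht hρ
            have hs := shapeOn_swap_mul hM ht hρ
            have hc := count_two_cycleType_swap_mul (hlt j hj).ne' e1 e2
            rw [Equiv.swap_mul_self_mul] at hs hc
            rw [shapeOn_cons_of_mem hl hσ.1 hj hσ.2, hs, hc, pow_succ]
            ring
        rw [Finset.sum_congr rfl key, Finset.sum_const, List.toFinset_card_of_nodup ht,
          nsmul_eq_mul, mul_assoc]

theorem sum_involutions {S : Type*} [CommRing S] (τ : S) (f : FibWord → S) :
    ∑ σ : Equiv.Perm (Fin N), (if σ * σ = 1 then f (shape (tableauP σ)) else 0) *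
      τ ^ σ.cycleType.count 2 = wordSum τ N f := by
  have hp : (List.finRange N).reverse.Pairwise (· > ·) := by
    rw [List.pairwise_reverse]
    exact List.pairwise_lt_finRange N
  have h := sum_involutionsOn τ _ hp f
  rw [List.length_reverse, List.length_finRange] at h
  rw [← h, involutionsOn, Finset.sum_filter]
  refine Finset.sum_congr rfl fun σ _ => ?_
  simp [shapeOn, tableauP, List.ofFn_eq_map, List.map_reverse]

end Involutions

/-! ### Collapse of `ν` to the harmonic function, and normalisation. -/

theorem nu_plancherel (π : FibWord → ℝ) {n : ℕ} (σ : Equiv.Perm (Fin n)) :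
    nu π plancherel σ = if σ * σ = 1 then π (shape (tableauP σ)) else 0 := by
  rw [nu, chainWeight_plancherel]
  have := (dim_pos (shape (tableauP σ))).ne'
  split_ifs
  · field_simp
  · rfl

theorem wordSum_cloneHarmonic {S : Type*} [CommRing S] (g : ℝ →+* S) (x y : ℕ → ℝ) (τ : S)
    (n : ℕ) :
    wordSum τ n (fun w => g (cloneHarmonic x y w)) =
      g (∏ k ∈ Finset.Icc 1 n, x k)⁻¹ * wordSum τ n (fun w => g (cloneSchur x y w)) := by
  rw [← wordSum_mul_left]
  refine wordSum_congr τ fun w hw => ?_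
  rw [cloneHarmonic, hw, div_eq_inv_mul, map_mul]

theorem FibonacciPositive.prod_pos {x y : ℕ → ℝ} (h : FibonacciPositive x y) (n : ℕ) :
    0 < ∏ k ∈ Finset.Icc 1 n, x k := by
  refine Finset.prod_pos fun k hk => ?_
  obtain ⟨k, rfl⟩ := Nat.exists_eq_add_of_le' (Finset.mem_Icc.1 hk).1
  exact h.x_pos k

end YoungFibonacci

theorem mainTheorem10 (x y : ℕ → ℝ) (hxy : YoungFibonacci.FibonacciPositive x y) (n : ℕ) :
    (∀ σ : Equiv.Perm (Fin n),
      0 ≤ YoungFibonacci.nu (YoungFibonacci.cloneHarmonic x y) YoungFibonacci.plancherel σ) ∧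
    (∑ σ : Equiv.Perm (Fin n),
      YoungFibonacci.nu (YoungFibonacci.cloneHarmonic x y) YoungFibonacci.plancherel σ = 1) ∧
    ∀ τ : ℂ,
      ∑ σ : Equiv.Perm (Fin n),
        ((YoungFibonacci.nu (YoungFibonacci.cloneHarmonic x y) YoungFibonacci.plancherel σ : ℝ) : ℂ)
          * τ ^ (σ.cycleType.count 2) =
      (∏ k ∈ Finset.Icc 1 n, (x k : ℂ))⁻¹ *
        (YoungFibonacci.quadridiagonal (fun k => (x k : ℂ)) (fun k => (y k : ℂ)) τ n).det := by
  open YoungFibonacci in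
  refine ⟨fun σ => ?_, ?_, fun τ => ?_⟩
  · rw [nu_plancherel]
    split_ifs
    · exact div_nonneg (hxy _).le (hxy.prod_pos _).le
    · exact le_rfl
  · have h := sum_involutions (N := n) 1 (fun w => cloneHarmonic x y w)
    have h' := wordSum_cloneHarmonic (RingHom.id ℝ) x y 1 n
    rw [wordSum_one_cloneSchur] at h'
    simp only [RingHom.id_apply, inv_mul_cancel₀ (hxy.prod_pos n).ne'] at h'
    rw [h'] at h
    simpa [nu_plancherel] using h
  · have h := sum_involutions (N := n) τ (fun w => Complex.ofRealHom (cloneHarmonic x y w))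
    rw [wordSum_cloneHarmonic, wordSum_cloneSchur_eq_det] at h
    simp only [Complex.ofRealHom_eq_coe, Complex.ofReal_inv, Complex.ofReal_prod] at h
    rw [← h]
    refine Finset.sum_congr rfl fun σ _ => ?_
    rw [nu_plancherel]
    split_ifs <;> simp
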